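/- Let $G$ be a discrete group and $H\subseteq G$ a subgroup. Let $\lambda_g$ ($g\in G$) be the left translation unitaries on $\ell^2(G)$, $(\lambda_g f)(k)=f(g^{-1}k)$, let $L(G)=\{\lambda_g: g\in G\}''$ be the group von Neumann algebra, and regard $L(H)$ as the von Neumann subalgebra $\{\lambda_h: h\in H\}''\subseteq L(G)$. Let $x\in L(G)$ be a one sided quasi-normalizer of $L(H)$, that is, there are finitely many $x_1,\dots,x_n\in L(G)$ such that $$L(H)\,x\subseteq \sum_{i=1}^n x_i\,L(H).$$ Let $x=\sum_{g\in G}\alpha_g g$ be the Fourier series of $x$, i.e. $x\delta_e=\sum_{g\in G}\alpha_g\delta_g$ in $\ell^2(G)$, where $(\delta_g)_{g\in G}$ is the canonical orthonormal basis and $e$ is the identity of $G$. If $g_0\in G$ satisfies $\alpha_{g_0}\neq 0$, then $g_0$ is a one sided quasi-normalizer of $H$ in $G$: there is a finite set $\{g_1,\dots,g_m\}\subseteq G$ such that $$Hg_0\subseteq \bigcup_{i=1}^m g_iH.$$ -/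

import Mathlib

open scoped Pointwise lp ENNReal

noncomputable section

namespace GroupVN

section VonNeumann

variable {E : Type*} [NormedAddCommGroup E] [InnerProductSpace ℂ E] [CompleteSpace E]

/-- The von Neumann algebra generated by a set `S` of bounded operators on a Hilbert space: the
double commutant of `S ∪ S*` (`StarSubalgebra.centralizer ℂ S` is the commutant of
`S ∪ S*`). -/
def generated (S : Set (E →L[ℂ] E)) : VonNeumannAlgebra E where
  toStarSubalgebra :=
    StarSubalgebra.centralizer ℂ (StarSubalgebra.centralizer ℂ S : Set (E →L[ℂ] E))
  centralizer_centralizer' := by simp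

/-- `x ∈ M` is a one sided quasi-normalizer of `B` in `M`: there are finitely many
`y₁, …, yₙ ∈ M` with `B x ⊆ ∑ᵢ yᵢ B`. -/
def IsOneSidedQuasiNormalizer (M B : VonNeumannAlgebra E) (x : E →L[ℂ] E) : Prop :=
  x ∈ M ∧ ∃ (n : ℕ) (y : Fin n → (E →L[ℂ] E)), (∀ i, y i ∈ M) ∧
    ∀ b ∈ B, ∃ c : Fin n → (E →L[ℂ] E), (∀ i, c i ∈ B) ∧ b * x = ∑ i, y i * c i

end VonNeumann

variable {G : Type*} [Group G]

theorem memℓp_translate (g : G) (f : ℓ²(G, ℂ)) : Memℓp (fun k : G => f (g⁻¹ * k)) 2 := by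
  have h := (memℓp_gen_iff (p := 2) (by norm_num)).1 (lp.memℓp f)
  exact (memℓp_gen_iff (p := 2) (by norm_num)).2
    ((Equiv.mulLeft g⁻¹).summable_iff (f := fun k => ‖f k‖ ^ (2 : ℝ≥0∞).toReal) |>.2 h)

theorem norm_translate (g : G) (f : ℓ²(G, ℂ)) :
    ‖(⟨fun k : G => f (g⁻¹ * k), memℓp_translate g f⟩ : ℓ²(G, ℂ))‖ = ‖f‖ := by
  rw [lp.norm_eq_tsum_rpow (by norm_num), lp.norm_eq_tsum_rpow (by norm_num)]
  congr 1
  exact (Equiv.mulLeft g⁻¹).tsum_eq (fun k => ‖f k‖ ^ (2 : ℝ≥0∞).toReal)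

/-- The left translation operator `λ_g` on `ℓ²(G)`: `(λ_g f)(k) = f(g⁻¹ k)`. -/
def leftTranslation (g : G) : ℓ²(G, ℂ) →L[ℂ] ℓ²(G, ℂ) :=
  LinearIsometry.toContinuousLinearMap
    { toFun := fun f => ⟨fun k => f (g⁻¹ * k), memℓp_translate g f⟩
      map_add' := fun _ _ => rfl
      map_smul' := fun _ _ => rfl
      norm_map' := norm_translate g }

/-- The canonical basis vector `δ_g` of `ℓ²(G)`. -/
def delta (g : G) : ℓ²(G, ℂ) :=
  open Classical in lp.single 2 g (1 : ℂ)

/-- `L(H)` for a subgroup `H` of `G`, as a von Neumann subalgebra of `B(ℓ²(G))`: the von Neumann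
algebra generated by the `λ_h`, `h ∈ H`. -/
def subgroupAlgebra (H : Subgroup G) : VonNeumannAlgebra ℓ²(G, ℂ) :=
  generated (leftTranslation '' (H : Set G))

/-- The group von Neumann algebra `L(G)`, generated by all `λ_g`, `g ∈ G`. -/
def groupAlgebra (G : Type*) [Group G] : VonNeumannAlgebra ℓ²(G, ℂ) :=
  generated (Set.range (leftTranslation (G := G)))

/-- The Fourier coefficient `α_g` of `x = ∑ α_g g`: the coordinate at `g` of the vector
`x δ_e ∈ ℓ²(G)`. -/
def groupFourierCoeff (x : ℓ²(G, ℂ) →L[ℂ] ℓ²(G, ℂ)) (g : G) : ℂ :=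
  x (delta 1) g

/-- `g ∈ G` is a one sided quasi-normalizer of the subgroup `H`: there is a finite `F ⊆ G` with
`H g ⊆ ⋃_{k ∈ F} k H`. -/
def IsGroupOneSidedQuasiNormalizer (H : Subgroup G) (g : G) : Prop :=
  ∃ F : Finset G, MulOpposite.op g • (H : Set G) ⊆ ⋃ k ∈ F, k • (H : Set G)

end GroupVN

end

/-! Let `E` be the projection onto `ℓ²(H)` and `T i = y i * E`. The vectors `λ_h x δ_e`, `h ∈ H`,
all lie in `∑ T i ℓ²(G)`, a space of dimension at most `n` over `H` acting on the right. The
coordinate of `λ_h x δ_e` at `h g₀` is always `α`, so each coset `h g₀ H` uses up a fixed share of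
that dimension and only finitely many can occur.

The projection onto the closure of this space is replaced by `R S R`, where `S = ∑ T i (T i)*` and
`R = (S + ε)^(-1/2)`. `norm_inner_le_of_invSqrt` bounds `|α|` by the mass of `R S R` at `δ_{h g₀}`
up to an error of order `√ε`; `sum_norm_sq_indicatorOp_star_le` bounds the total mass over distinct
cosets by `n`. `card_mul_norm_sq_le` combines the two. -/

namespace GroupVN

open scoped InnerProductSpace InnerProduct ComplexConjugate

/-! ### Approximate range projections -/

section Regularization

variable {E : Type*} [NormedAddCommGroup E] [InnerProductSpace ℂ E] [CompleteSpace E]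

/-- For positive `S` and `ε > 0`, the operator `R = (S + ε)^(-1/2)`. -/
theorem exists_invSqrt_add_smul_one {S : E →L[ℂ] E} (hS : 0 ≤ S) {ε : ℝ} (hε : 0 < ε) :
    ∃ R : E →L[ℂ] E, IsSelfAdjoint R ∧ R * S * R + (ε : ℂ) • (R * R) = 1 ∧
      ∀ B : E →L[ℂ] E, Commute S B → Commute R B := by
  have hsa : IsSelfAdjoint S := IsSelfAdjoint.of_nonneg hS
  set f : ℝ → ℝ := fun t => (√(t + ε))⁻¹ with hf
  have hspec : ∀ t ∈ spectrum ℝ S, 0 < t + ε := fun t ht => by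
    have := spectrum_nonneg_of_nonneg hS ht
    linarith
  have hfc : ContinuousOn f (spectrum ℝ S) :=
    ContinuousOn.inv₀ (by fun_prop) fun t ht => (Real.sqrt_pos.2 (hspec t ht)).ne'
  refine ⟨cfc f S, cfc_predicate f S, ?_, fun B hB => hB.cfc_real f⟩
  have h1 : cfc f S * S * cfc f S = cfc (fun t => f t * t * f t) S := by
    rw [cfc_mul (fun t => f t * t) f S (hfc.mul continuousOn_id) hfc,
      cfc_mul f (fun t => t) S hfc continuousOn_id, cfc_id' ℝ S]
  have h2 : (ε : ℂ) • (cfc f S * cfc f S) = cfc (fun t => ε * (f t * f t)) S := by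
    rw [cfc_const_mul ε (fun t => f t * f t) S (hfc.mul hfc), cfc_mul f f S hfc hfc]
    exact Complex.coe_smul ε _
  rw [h1, h2, ← cfc_add S (fun t => f t * t * f t) (fun t => ε * (f t * f t))
    ((hfc.mul continuousOn_id).mul hfc) (continuousOn_const.mul (hfc.mul hfc)),
    ← cfc_const_one ℝ S]
  refine cfc_congr fun t ht => ?_
  have hp := hspec t ht
  have hs : √(t + ε) ^ 2 = t + ε := Real.sq_sqrt hp.le
  have hs0 : √(t + ε) ≠ 0 := (Real.sqrt_pos.2 hp).ne'
  simp only [hf]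
  field_simp
  linarith

variable {ι : Type*} [Fintype ι] {T : ι → (E →L[ℂ] E)} {R : E →L[ℂ] E} {ε : ℝ}

theorem inner_eq_sum_add_of_invSqrt (hR : IsSelfAdjoint R)
    (h1 : R * (∑ i, T i * star (T i)) * R + (ε : ℂ) • (R * R) = 1) (u w : E) :
    ⟪u, w⟫_ℂ = ∑ i, ⟪star (T i) (R u), star (T i) (R w)⟫_ℂ + ε * ⟪R u, R w⟫_ℂ := by
  have hRs : ∀ a b : E, ⟪a, R b⟫_ℂ = ⟪R a, b⟫_ℂ := fun a b => by
    conv_rhs => rw [← hR.star_eq]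
    exact (ContinuousLinearMap.adjoint_inner_left R b a).symm
  have h := congrArg (fun A : E →L[ℂ] E => ⟪u, A w⟫_ℂ) h1
  simp only [add_apply, mul_apply_eq_comp, inner_add_right,
    smul_apply, inner_smul_right, one_apply_eq_self, hRs,
    sum_apply, inner_sum] at h
  rw [← h]
  congr 1
  · exact Finset.sum_congr rfl fun i _ =>
      (ContinuousLinearMap.adjoint_inner_left (T i) _ _).symm
  · rw [hRs]

theorem norm_sq_eq_of_invSqrt (hR : IsSelfAdjoint R)
    (h1 : R * (∑ i, T i * star (T i)) * R + (ε : ℂ) • (R * R) = 1) (u : E) :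
    ‖u‖ ^ 2 = ∑ i, ‖star (T i) (R u)‖ ^ 2 + ε * ‖R u‖ ^ 2 := by
  have h := inner_eq_sum_add_of_invSqrt hR h1 u u
  simp only [inner_self_eq_norm_sq_to_K, Complex.coe_algebraMap] at h
  exact_mod_cast h

/-- The relation `h1` makes `(T i)* R` a contraction, and `R T i` is its adjoint. -/
theorem norm_invSqrt_apply_le (hε : 0 ≤ ε) (hR : IsSelfAdjoint R)
    (h1 : R * (∑ i, T i * star (T i)) * R + (ε : ℂ) • (R * R) = 1) (i : ι) (v : E) :
    ‖R (T i v)‖ ≤ ‖v‖ := by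
  have hstar : star (R * T i) = star (T i) * R := by rw [star_mul, hR.star_eq]
  have hle : ‖star (T i) * R‖ ≤ 1 := by
    refine ContinuousLinearMap.opNorm_le_bound _ zero_le_one fun u => ?_
    rw [one_mul]
    refine (sq_le_sq₀ (by positivity) (norm_nonneg u)).1 ?_
    rw [norm_sq_eq_of_invSqrt hR h1 u]
    have := Finset.single_le_sum (f := fun i => ‖star (T i) (R u)‖ ^ 2)
      (fun j _ => sq_nonneg _) (Finset.mem_univ i)
    have h2 : 0 ≤ ε * ‖R u‖ ^ 2 := by positivity
    simp only [mul_apply_eq_comp] at this ⊢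
    linarith
  rw [← hstar, norm_star] at hle
  simpa using (R * T i).le_of_opNorm_le hle v

/-- Cauchy–Schwarz on both terms of `inner_eq_sum_add_of_invSqrt`. In the second, `√ε ‖R u‖ ≤ ‖u‖`
uses only half of `ε`, while `‖R w‖` is bounded independently of `ε`; a factor `√ε` survives. -/
theorem norm_inner_le_of_invSqrt (hε : 0 ≤ ε) (hR : IsSelfAdjoint R)
    (h1 : R * (∑ i, T i * star (T i)) * R + (ε : ℂ) • (R * R) = 1) (u : E) (v : ι → E) :
    ‖⟪u, ∑ i, T i (v i)⟫_ℂ‖ ≤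
      √(∑ i, ‖star (T i) (R u)‖ ^ 2) * ‖∑ i, T i (v i)‖ + √ε * (‖u‖ * ∑ i, ‖v i‖) := by
  set w := ∑ i, T i (v i) with hw
  rw [inner_eq_sum_add_of_invSqrt hR h1 u w]
  refine (norm_add_le _ _).trans (add_le_add ?_ ?_)
  · calc ‖∑ i, ⟪star (T i) (R u), star (T i) (R w)⟫_ℂ‖
        ≤ ∑ i, ‖star (T i) (R u)‖ * ‖star (T i) (R w)‖ :=
          norm_sum_le_of_le _ fun i _ => norm_inner_le_norm _ _
      _ ≤ √(∑ i, ‖star (T i) (R u)‖ ^ 2) * √(∑ i, ‖star (T i) (R w)‖ ^ 2) :=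
          Real.sum_mul_le_sqrt_mul_sqrt _ _ _
      _ ≤ _ := by
          gcongr
          refine Real.sqrt_le_left (norm_nonneg w) |>.2 ?_
          rw [norm_sq_eq_of_invSqrt hR h1 w]
          have : 0 ≤ ε * ‖R w‖ ^ 2 := by positivity
          linarith
  · have hRu : √ε * ‖R u‖ ≤ ‖u‖ := by
      refine (sq_le_sq₀ (by positivity) (norm_nonneg u)).1 ?_
      rw [mul_pow, Real.sq_sqrt hε, norm_sq_eq_of_invSqrt hR h1 u]
      have : 0 ≤ ∑ i, ‖star (T i) (R u)‖ ^ 2 := Finset.sum_nonneg fun i _ => sq_nonneg _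
      linarith
    have hRw : ‖R w‖ ≤ ∑ i, ‖v i‖ := by
      rw [hw, map_sum]
      exact norm_sum_le_of_le _ fun i _ => norm_invSqrt_apply_le hε hR h1 i (v i)
    calc ‖(ε : ℂ) * ⟪R u, R w⟫_ℂ‖ = ε * ‖⟪R u, R w⟫_ℂ‖ := by
          rw [norm_mul, Complex.norm_real, Real.norm_of_nonneg hε]
      _ ≤ ε * (‖R u‖ * ‖R w‖) := by gcongr; exact norm_inner_le_norm _ _
      _ = √ε * ((√ε * ‖R u‖) * ‖R w‖) := by
          nth_rw 1 [← Real.mul_self_sqrt hε]; ring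
      _ ≤ _ := by gcongr

end Regularization

/-! ### Translations and coordinate projections on `ℓ²(G)` -/

section Operators

variable {G : Type*}

/-- The unitary `f ↦ f ∘ σ` of `ℓ²(G)` induced by a permutation `σ` of `G`. -/
noncomputable def permOp (σ : Equiv.Perm G) : ℓ²(G, ℂ) →L[ℂ] ℓ²(G, ℂ) :=
  LinearMap.mkContinuous
    { toFun := fun f => ⟨fun k => f (σ k), (memℓp_gen_iff (p := 2) (by norm_num)).2
        (σ.summable_iff (f := fun k => ‖f k‖ ^ (2 : ℝ≥0∞).toReal) |>.2
          ((memℓp_gen_iff (p := 2) (by norm_num)).1 (lp.memℓp f)))⟩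
      map_add' := fun _ _ => rfl
      map_smul' := fun _ _ => rfl } 1 fun f => by
    rw [one_mul, lp.norm_eq_tsum_rpow (by norm_num), lp.norm_eq_tsum_rpow (by norm_num)]
    exact le_of_eq (congrArg (· ^ _) (σ.tsum_eq fun k => ‖f k‖ ^ (2 : ℝ≥0∞).toReal))

theorem permOp_apply (σ : Equiv.Perm G) (f : ℓ²(G, ℂ)) (k : G) : permOp σ f k = f (σ k) := rfl

theorem star_permOp (σ : Equiv.Perm G) : star (permOp σ) = permOp σ.symm := by
  symm
  rw [ContinuousLinearMap.star_eq_adjoint, ContinuousLinearMap.eq_adjoint_iff]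
  intro f g
  rw [lp.inner_eq_tsum, lp.inner_eq_tsum, ← σ.tsum_eq]
  simp [permOp_apply]

open Classical in
/-- Multiplication by the indicator function of `s` on `ℓ²(G)`. -/
noncomputable def indicatorOp (s : Set G) : ℓ²(G, ℂ) →L[ℂ] ℓ²(G, ℂ) :=
  LinearMap.mkContinuous
    { toFun := fun f => ⟨fun k => if k ∈ s then f k else 0,
        (lp.memℓp f).mono' (fun k => by split_ifs <;> simp)⟩
      map_add' := fun f g => lp.ext (funext fun k => by
        change (if k ∈ s then (f + g) k else 0) =
          (if k ∈ s then f k else 0) + if k ∈ s then g k else 0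
        split_ifs <;> simp)
      map_smul' := fun c f => lp.ext (funext fun k => by
        change (if k ∈ s then (c • f) k else 0) = c • if k ∈ s then f k else 0
        split_ifs <;> simp) } 1 fun f => by
    rw [one_mul]
    exact lp.norm_mono (by norm_num) fun k => by
      by_cases hk : k ∈ s <;> simp [hk]

theorem indicatorOp_apply_of_mem {s : Set G} (f : ℓ²(G, ℂ)) {k : G} (hk : k ∈ s) :
    indicatorOp s f k = f k := if_pos hk

theorem indicatorOp_apply_of_notMem {s : Set G} (f : ℓ²(G, ℂ)) {k : G} (hk : k ∉ s) :
    indicatorOp s f k = 0 := if_neg hk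

theorem star_indicatorOp (s : Set G) : star (indicatorOp s) = indicatorOp s := by
  symm
  rw [ContinuousLinearMap.star_eq_adjoint, ContinuousLinearMap.eq_adjoint_iff]
  intro f g
  rw [lp.inner_eq_tsum, lp.inner_eq_tsum]
  refine tsum_congr fun k => ?_
  by_cases hk : k ∈ s
  · simp [indicatorOp_apply_of_mem _ hk]
  · simp [indicatorOp_apply_of_notMem _ hk]

theorem commute_permOp_indicatorOp {s : Set G} {σ : Equiv.Perm G} (h : ∀ k, σ k ∈ s ↔ k ∈ s) :
    Commute (permOp σ) (indicatorOp s) := by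
  refine ContinuousLinearMap.ext fun f => lp.ext (funext fun k => ?_)
  by_cases hk : k ∈ s
  · simp [permOp_apply, indicatorOp_apply_of_mem _ hk, indicatorOp_apply_of_mem _ ((h k).2 hk)]
  · simp [permOp_apply, indicatorOp_apply_of_notMem _ hk,
      indicatorOp_apply_of_notMem _ (mt (h k).1 hk)]

theorem inner_delta_left (g : G) (f : ℓ²(G, ℂ)) : ⟪delta g, f⟫_ℂ = f g := by
  simp [delta, lp.inner_single_left]

theorem norm_delta (g : G) : ‖delta g‖ = 1 := by
  classical
  rw [delta, lp.norm_single (by norm_num)]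
  simp

theorem delta_apply_self (g : G) : delta g g = 1 := by simp [delta]

theorem delta_apply_of_ne {g k : G} (h : k ≠ g) : delta g k = 0 := by
  classical
  exact lp.single_apply_ne _ _ _ h

theorem permOp_delta (σ : Equiv.Perm G) (g : G) : permOp σ (delta (σ g)) = delta g := by
  ext k
  rw [permOp_apply]
  by_cases h : k = g
  · rw [h, delta_apply_self, delta_apply_self]
  · rw [delta_apply_of_ne h, delta_apply_of_ne (σ.injective.ne h)]

theorem indicatorOp_delta {s : Set G} {g : G} (hg : g ∈ s) :
    indicatorOp s (delta g) = delta g := by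
  ext k
  by_cases hk : k ∈ s
  · rw [indicatorOp_apply_of_mem _ hk]
  · rw [indicatorOp_apply_of_notMem _ hk, delta_apply_of_ne (ne_of_mem_of_not_mem hg hk).symm]

theorem hasSum_norm_sq (f : ℓ²(G, ℂ)) : HasSum (fun k => ‖f k‖ ^ 2) (‖f‖ ^ 2) := by
  simpa using lp.hasSum_norm (p := 2) (by norm_num) f

variable [Group G]

theorem leftTranslation_eq_permOp (g : G) :
    leftTranslation g = permOp (Equiv.mulLeft g⁻¹) := rfl

theorem commute_permOp_mulLeft_mulRight (g h : G) :
    Commute (permOp (Equiv.mulLeft g)) (permOp (Equiv.mulRight h)) := by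
  refine ContinuousLinearMap.ext fun f => lp.ext (funext fun k => ?_)
  simp [permOp_apply, mul_assoc]

theorem leftTranslation_mem_subgroupAlgebra {H : Subgroup G} {h : G} (hh : h ∈ H) :
    leftTranslation h ∈ subgroupAlgebra H := by
  change _ ∈ StarSubalgebra.centralizer ℂ _
  rw [StarSubalgebra.mem_centralizer_iff]
  intro B hB
  rw [SetLike.mem_coe] at hB
  have hB' := star_mem hB
  rw [StarSubalgebra.mem_centralizer_iff] at hB hB'
  have hm : leftTranslation h ∈ leftTranslation '' (H : Set G) := ⟨h, hh, rfl⟩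
  exact ⟨(hB _ hm).1.symm, (hB' _ hm).1.symm⟩

/-- Right translations lie in the commutant of the left ones. -/
theorem commute_permOp_mulRight_of_mem_groupAlgebra {x : ℓ²(G, ℂ) →L[ℂ] ℓ²(G, ℂ)}
    (hx : x ∈ groupAlgebra G) (g : G) : Commute (permOp (Equiv.mulRight g)) x := by
  change _ ∈ StarSubalgebra.centralizer ℂ _ at hx
  rw [StarSubalgebra.mem_centralizer_iff] at hx
  refine (hx _ ?_).1
  rw [SetLike.mem_coe, StarSubalgebra.mem_centralizer_iff]
  rintro _ ⟨k, rfl⟩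
  rw [leftTranslation_eq_permOp, star_permOp, Equiv.mulLeft_symm]
  exact ⟨commute_permOp_mulLeft_mulRight _ _, commute_permOp_mulLeft_mulRight _ _⟩

theorem commute_indicatorOp_of_mem_subgroupAlgebra {H : Subgroup G}
    {c : ℓ²(G, ℂ) →L[ℂ] ℓ²(G, ℂ)} (hc : c ∈ subgroupAlgebra H) :
    Commute (indicatorOp (H : Set G)) c := by
  change _ ∈ StarSubalgebra.centralizer ℂ _ at hc
  rw [StarSubalgebra.mem_centralizer_iff] at hc
  refine (hc _ ?_).1
  rw [SetLike.mem_coe, StarSubalgebra.mem_centralizer_iff]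
  rintro _ ⟨h, hh, rfl⟩
  rw [SetLike.mem_coe] at hh
  rw [leftTranslation_eq_permOp, star_permOp, Equiv.mulLeft_symm]
  exact ⟨commute_permOp_indicatorOp fun k => by simp [H.mul_mem_cancel_left, hh],
    commute_permOp_indicatorOp fun k => by simp [H.mul_mem_cancel_left, hh]⟩

/-- If `A` commutes with the right translations by `H`, then for elements `g ∈ t` representing
distinct left cosets of `H`, the vectors `1_H A* δ_g` have square norms summing up to at most
`‖A δ_e‖²`. -/
theorem sum_norm_sq_indicatorOp_star_le {H : Subgroup G} {A : ℓ²(G, ℂ) →L[ℂ] ℓ²(G, ℂ)}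
    (hA : ∀ h ∈ H, Commute (permOp (Equiv.mulRight h)) A) {κ : Type*} (t : Finset κ)
    (g : κ → G) (hg : Set.InjOn (fun j => (g j : G ⧸ H)) t) :
    ∑ j ∈ t, ‖indicatorOp (H : Set G) (star A (delta (g j)))‖ ^ 2 ≤ ‖A (delta 1)‖ ^ 2 := by
  set f := A (delta 1) with hf
  have hfs := hasSum_norm_sq f
  -- Right translation carries `δ_e` to `δ_h` and commutes with `A`, so the entries of `A δ_h` are
  -- translated entries of `f = A δ_e`.
  have hval : ∀ (j : κ) (h : H), ‖star A (delta (g j)) h‖ = ‖f (g j * (h : G)⁻¹)‖ := by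
    intro j h
    have h1 := congrArg (fun B : ℓ²(G, ℂ) →L[ℂ] ℓ²(G, ℂ) => B (delta 1) (g j))
      (hA _ (H.inv_mem h.2))
    have h2 := permOp_delta (Equiv.mulRight (h : G)⁻¹) (h : G)
    simp only [Equiv.coe_mulRight, mul_inv_cancel] at h2
    simp only [mul_apply_eq_comp, h2, permOp_apply, Equiv.coe_mulRight] at h1
    rw [← hf] at h1
    rw [h1, ← inner_delta_left, ← inner_delta_left, ContinuousLinearMap.star_eq_adjoint,
      ContinuousLinearMap.adjoint_inner_right, norm_inner_symm]
  have hnorm : ∀ j, ‖indicatorOp (H : Set G) (star A (delta (g j)))‖ ^ 2 =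
      ∑' h : H, ‖f (g j * (h : G)⁻¹)‖ ^ 2 := by
    intro j
    rw [← (hasSum_norm_sq _).tsum_eq]
    rw [← tsum_subtype_eq_of_support_subset (s := (H : Set G))]
    · refine tsum_congr fun h => ?_
      rw [indicatorOp_apply_of_mem _ h.2]
      exact congrArg (· ^ 2) (hval j h)
    · intro k hk
      by_contra hk'
      exact hk (by simp [indicatorOp_apply_of_notMem _ hk'])
  -- Distinct cosets give disjoint sets of entries of `f`, so the sums add up to at most `‖f‖²`.
  have hinj : Function.Injective (fun p : t × H => g p.1 * (p.2 : G)⁻¹) := by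
    rintro ⟨i, h⟩ ⟨j, k⟩ hij
    dsimp only at hij
    have hcoset : (g i : G ⧸ H) = g j := by
      have := congrArg (fun a : G => (a : G ⧸ H)) hij
      simpa [QuotientGroup.mk_mul_of_mem, H.inv_mem] using this
    have hij' : i = j := Subtype.ext (hg i.2 j.2 hcoset)
    subst hij'
    simpa using hij
  have hsum : Summable (fun p : t × H => ‖f (g p.1 * (p.2 : G)⁻¹)‖ ^ 2) :=
    hfs.summable.comp_injective hinj
  simp only [hnorm]
  rw [← Finset.sum_coe_sort t (fun j => ∑' h : H, ‖f (g j * (h : G)⁻¹)‖ ^ 2),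
    ← tsum_fintype (L := SummationFilter.unconditional _), ← hsum.tsum_prod, ← hfs.tsum_eq]
  exact hsum.tsum_le_tsum_of_inj _ hinj (fun _ _ => sq_nonneg _) (fun _ => le_rfl) hfs.summable

end Operators

/-! ### Counting cosets -/

section Main

variable {G : Type*} [Group G]

/-- If `H g` is not covered by finitely many left cosets of `H`, then it meets infinitely many. -/
theorem infinite_cosets_of_not_isGroupOneSidedQuasiNormalizer {H : Subgroup G} {g : G}
    (hg : ¬ IsGroupOneSidedQuasiNormalizer H g) :
    ((fun h : G => ((h * g : G) : G ⧸ H)) '' (H : Set G)).Infinite := by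
  classical
  intro hfin
  refine hg ⟨hfin.toFinset.image Quotient.out, ?_⟩
  rintro _ ⟨h, hh, rfl⟩
  simp only [Set.mem_iUnion]
  refine ⟨((h * g : G) : G ⧸ H).out, Finset.mem_image_of_mem _ (by simpa using ⟨h, hh, rfl⟩), ?_⟩
  rw [mem_leftCoset_iff]
  exact QuotientGroup.eq.1 (Quotient.out_eq' _)

/-- The counting estimate: if for every `h ∈ H` the vector `λ_h x δ_e` lies in
`∑ᵢ yᵢ ℓ²(H)`, then the number of left cosets of `H` of the form `h g₀ H` is controlled by the
Fourier coefficient of `x` at `g₀`. -/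
theorem card_mul_norm_sq_le {H : Subgroup G} {n : ℕ} {x : ℓ²(G, ℂ) →L[ℂ] ℓ²(G, ℂ)}
    {y : Fin n → (ℓ²(G, ℂ) →L[ℂ] ℓ²(G, ℂ))} (hy : ∀ i, y i ∈ groupAlgebra G)
    (hxy : ∀ b ∈ subgroupAlgebra H, ∃ c : Fin n → (ℓ²(G, ℂ) →L[ℂ] ℓ²(G, ℂ)),
      (∀ i, c i ∈ subgroupAlgebra H) ∧ b * x = ∑ i, y i * c i)
    {κ : Type*} (t : Finset κ) (h : κ → G) (hh : ∀ j ∈ t, h j ∈ H) (g₀ : G)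
    (hinj : Set.InjOn (fun j => ((h j * g₀ : G) : G ⧸ H)) t) :
    t.card * (‖groupFourierCoeff x g₀‖ / 2) ^ 2 ≤ n * ‖x (delta 1)‖ ^ 2 := by
  set α := groupFourierCoeff x g₀ with hα
  rcases eq_or_ne α 0 with h0 | h0
  · rw [h0, norm_zero, zero_div, zero_pow two_ne_zero, mul_zero]
    positivity
  set E := indicatorOp (H : Set G) with hE
  set T : Fin n → (ℓ²(G, ℂ) →L[ℂ] ℓ²(G, ℂ)) := fun i => y i * E with hT
  have hv : ∀ j : κ, ∃ v : Fin n → ℓ²(G, ℂ), j ∈ t →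
      leftTranslation (h j) (x (delta 1)) = ∑ i, T i (v i) := by
    intro j
    by_cases hj : j ∈ t
    · obtain ⟨c, hc, hcx⟩ := hxy _ (leftTranslation_mem_subgroupAlgebra (hh j hj))
      refine ⟨fun i => c i (delta 1), fun _ => ?_⟩
      have := congrArg (fun B : ℓ²(G, ℂ) →L[ℂ] ℓ²(G, ℂ) => B (delta 1)) hcx
      simp only [mul_apply_eq_comp, sum_apply] at this
      rw [this]
      -- `c i` commutes with `E` and `E δ_e = δ_e`, so `y i` may be replaced by `T i`.
      refine Finset.sum_congr rfl fun i _ => ?_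
      have hcE := congrArg (fun B : ℓ²(G, ℂ) →L[ℂ] ℓ²(G, ℂ) => B (delta 1))
        (commute_indicatorOp_of_mem_subgroupAlgebra (hc i))
      simp only [mul_apply_eq_comp, indicatorOp_delta (s := (H : Set G)) H.one_mem]
        at hcE
      simp only [hT, mul_apply_eq_comp, hE, hcE]
    · exact ⟨0, fun hj' => (hj hj').elim⟩
  choose v hv using hv
  set C : ℝ := ∑ j ∈ t, ∑ i, ‖v j i‖ with hC
  have hC0 : 0 ≤ C := by positivity
  have hα0 : 0 < ‖α‖ := norm_pos_iff.2 h0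
  -- Here `ε` depends on `t` through `C`; this is harmless because the final bound is free of `ε`.
  -- The `+ 1` in the witness covers `C = 0`.
  obtain ⟨ε, hε, hεC⟩ : ∃ ε : ℝ, 0 < ε ∧ √ε * C ≤ ‖α‖ / 2 := by
    refine ⟨(‖α‖ / 2 / (C + 1)) ^ 2, by positivity, ?_⟩
    rw [Real.sqrt_sq (by positivity), div_mul_eq_mul_div, div_le_iff₀ (by positivity)]
    nlinarith
  have hS : 0 ≤ ∑ i, T i * star (T i) := Finset.sum_nonneg fun i _ => mul_star_self_nonneg _
  obtain ⟨R, hR, h1, hcomm⟩ := exists_invSqrt_add_smul_one hS hε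
  have hTstar : ∀ i, star (T i) = E * star (y i) := fun i => by
    simp only [hT, star_mul, hE, star_indicatorOp]
  have hρE : ∀ k ∈ H, Commute (permOp (Equiv.mulRight k)) E := fun k hk =>
    commute_permOp_indicatorOp fun l => by simp [H.mul_mem_cancel_right, hk]
  have hρR : ∀ k ∈ H, Commute (permOp (Equiv.mulRight k)) R := fun k hk => by
    refine (hcomm _ (Commute.symm (Commute.sum_right _ _ _ fun i _ => ?_))).symm
    rw [hTstar]
    exact ((commute_permOp_mulRight_of_mem_groupAlgebra (hy i) k).mul_right (hρE k hk)).mul_right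
      ((hρE k hk).mul_right (commute_permOp_mulRight_of_mem_groupAlgebra (star_mem (hy i)) k))
  -- Apply the coset estimate to `A = R * y i`: `E A* = (T i)* R`, and `A δ_e = R (T i δ_e)` has
  -- norm at most `1`.
  have htrace : ∀ i, ∑ j ∈ t, ‖star (T i) (R (delta (h j * g₀)))‖ ^ 2 ≤ 1 := by
    intro i
    have hle := sum_norm_sq_indicatorOp_star_le (A := R * y i) (fun k hk => (hρR k hk).mul_right
      (commute_permOp_mulRight_of_mem_groupAlgebra (hy i) k)) t (fun j => h j * g₀) hinj
    have hb := norm_invSqrt_apply_le hε.le hR h1 i (delta 1)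
    simp only [hT, mul_apply_eq_comp, hE,
      indicatorOp_delta (s := (H : Set G)) H.one_mem, norm_delta] at hb
    simp only [star_mul, hR.star_eq, mul_apply_eq_comp] at hle
    simp only [hTstar, mul_apply_eq_comp]
    exact hle.trans (pow_le_one₀ (norm_nonneg _) hb)
  have hM : ∀ j, ‖leftTranslation (h j) (x (delta 1))‖ = ‖x (delta 1)‖ := fun j =>
    norm_translate (h j) _
  have hkey : ∀ j ∈ t, (‖α‖ / 2) ^ 2 ≤
      (∑ i, ‖star (T i) (R (delta (h j * g₀)))‖ ^ 2) * ‖x (delta 1)‖ ^ 2 := by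
    intro j hj
    have hb := norm_inner_le_of_invSqrt hε.le hR h1 (delta (h j * g₀)) (v j)
    rw [← hv j hj, inner_delta_left, hM, norm_delta, one_mul] at hb
    have hαj : leftTranslation (h j) (x (delta 1)) (h j * g₀) = α := by
      rw [leftTranslation_eq_permOp, permOp_apply]
      simp [hα, groupFourierCoeff]
    rw [hαj] at hb
    have hCj : √ε * ∑ i, ‖v j i‖ ≤ √ε * C := by
      gcongr
      exact Finset.single_le_sum (f := fun j => ∑ i, ‖v j i‖) (fun _ _ => by positivity) hj
    have hq : 0 ≤ ∑ i, ‖star (T i) (R (delta (h j * g₀)))‖ ^ 2 := by positivity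
    rw [← Real.sq_sqrt hq, ← mul_pow]
    -- The error `√ε C` absorbs at most half of `‖α‖`.
    exact pow_le_pow_left₀ (by positivity) (by linarith) 2
  calc t.card * (‖α‖ / 2) ^ 2 = ∑ j ∈ t, (‖α‖ / 2) ^ 2 := by simp
    _ ≤ ∑ j ∈ t, (∑ i, ‖star (T i) (R (delta (h j * g₀)))‖ ^ 2) * ‖x (delta 1)‖ ^ 2 :=
        Finset.sum_le_sum hkey
    _ = (∑ i, ∑ j ∈ t, ‖star (T i) (R (delta (h j * g₀)))‖ ^ 2) * ‖x (delta 1)‖ ^ 2 := by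
        rw [← Finset.sum_mul, Finset.sum_comm]
    _ ≤ (∑ _i : Fin n, 1) * ‖x (delta 1)‖ ^ 2 := by
        gcongr with i
        exact htrace i
    _ = n * ‖x (delta 1)‖ ^ 2 := by simp

end Main

end GroupVN

theorem mainTheorem2 {G : Type*} [Group G] (H : Subgroup G)
    (x : ℓ²(G, ℂ) →L[ℂ] ℓ²(G, ℂ))
    (hx : GroupVN.IsOneSidedQuasiNormalizer
      (GroupVN.groupAlgebra G) (GroupVN.subgroupAlgebra H) x)
    (g₀ : G) (hg₀ : GroupVN.groupFourierCoeff x g₀ ≠ 0) :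
    GroupVN.IsGroupOneSidedQuasiNormalizer H g₀ := by
  by_contra hcon
  obtain ⟨-, n, y, hy, hxy⟩ := hx
  have hpos : 0 < (‖GroupVN.groupFourierCoeff x g₀‖ / 2) ^ 2 := by
    have := norm_pos_iff.2 hg₀
    positivity
  obtain ⟨N, hN⟩ := exists_nat_gt
    (n * ‖x (GroupVN.delta 1)‖ ^ 2 / (‖GroupVN.groupFourierCoeff x g₀‖ / 2) ^ 2)
  obtain ⟨t, hts, htN⟩ :=
    (GroupVN.infinite_cosets_of_not_isGroupOneSidedQuasiNormalizer hcon).exists_subset_card_eq N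
  have hch : ∀ q : G ⧸ H, ∃ h : G, q ∈ t → h ∈ H ∧ ((h * g₀ : G) : G ⧸ H) = q := fun q => by
    by_cases hq : q ∈ t
    · obtain ⟨h, hh, rfl⟩ := hts hq
      exact ⟨h, fun _ => ⟨hh, rfl⟩⟩
    · exact ⟨1, fun hq' => (hq hq').elim⟩
  choose h hh using hch
  have hle := GroupVN.card_mul_norm_sq_le hy hxy t h (fun q hq => (hh q hq).1) g₀
    fun q hq r hr hqr => by
      rw [← (hh q hq).2, ← (hh r hr).2]
      exact hqr
  rw [htN, ← le_div_iff₀ hpos] at hle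
  exact hN.not_ge hle
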